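/- Let $X$ and $Y$ be real normed spaces. A map $f : X \to Y$ is called a phase-isometry if $$\{\|f(x)+f(y)\|,\ \|f(x)-f(y)\|\} = \{\|x+y\|,\ \|x-y\|\} \qquad \text{for all } x, y \in X,$$ and it is called phase-equivalent to a linear isometry if there is a function $\varepsilon : X \to \{-1, 1\}$ such that $x \mapsto \varepsilon(x) f(x)$ is a linear isometry from $X$ to $Y$. **Proposition.** Let $f : X \to Y$ be a surjective phase-isometry satisfying the following two conditions: (a) for every $x \in X$ and every $t \in \mathbb{R}$, $f(tx) = t f(x)$ or $f(tx) = -t f(x)$; (b) for all linearly independent vectors $x, y \in X$ there exist real numbers $\alpha, \beta$ with $|\alpha| = |\beta| = 1$ such that $f(x+y) = \alpha f(x) + \beta f(y)$. Then $f$ is phase-equivalent to a linear isometry. -/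

import Mathlib

/-- `f` is a phase-isometry: the two-element (possibly degenerate) sets
`{‖f x + f y‖, ‖f x - f y‖}` and `{‖x + y‖, ‖x - y‖}` coincide for all `x`, `y`. -/
def IsPhaseIsometry {X Y : Type*} [NormedAddCommGroup X] [NormedAddCommGroup Y]
    (f : X → Y) : Prop :=
  ∀ x y : X, ({‖f x + f y‖, ‖f x - f y‖} : Set ℝ) = {‖x + y‖, ‖x - y‖}

/-- `f` is phase-equivalent to a linear isometry: for some phase function `ε : X → {-1, 1}`
the map `x ↦ ε x • f x` is a linear isometry. -/
def IsPhaseEquivLinearIsometry {X Y : Type*} [NormedAddCommGroup X] [NormedSpace ℝ X]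
    [NormedAddCommGroup Y] [NormedSpace ℝ Y] (f : X → Y) : Prop :=
  ∃ ε : X → ℝ, (∀ x, ε x = -1 ∨ ε x = 1) ∧ ∃ T : X →ₗᵢ[ℝ] Y, ∀ x, ε x • f x = T x

/-! Fix `e ≠ 0` and let `f e` settle all signs. On the span of `e` and any `x`, `f` agrees up to
sign with a linear map sending `e` to `f e` (`exists_isPhaseLift`). Its value at `x` is unique: the
opposite sign would be detected at `e + x` (`IsPhaseLift.unique`). These values define a map on `X`,
homogeneous by uniqueness and additive by `IsPhaseLift.add`; being equal to `f` up to sign, it is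
isometric. -/

section PhaseIsometry

/-- Equality up to sign. -/
def EqUpToSign {E : Type*} [Neg E] (u v : E) : Prop := u = v ∨ u = -v

namespace EqUpToSign

variable {E : Type*} [AddCommGroup E] {u v w : E}

theorem symm (h : EqUpToSign u v) : EqUpToSign v u := by
  rcases h with rfl | rfl
  · exact Or.inl rfl
  · exact Or.inr (neg_neg v).symm

theorem trans (h : EqUpToSign u v) (h' : EqUpToSign v w) : EqUpToSign u w := by
  rcases h with rfl | rfl
  · exact h'
  · rcases h' with rfl | rfl
    · exact Or.inr rfl
    · exact Or.inl (neg_neg w)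

theorem smul [Module ℝ E] (c : ℝ) (h : EqUpToSign u v) : EqUpToSign (c • u) (c • v) := by
  rcases h with rfl | rfl
  · exact Or.inl rfl
  · exact Or.inr (smul_neg c v)

end EqUpToSign

/-! ### Norms, injectivity up to sign, linear independence -/

theorem IsPhaseIsometry.eqUpToSign_of_map {X Y : Type*} [NormedAddCommGroup X]
    [NormedAddCommGroup Y] {f : X → Y} (hf : IsPhaseIsometry f) {x y : X}
    (h : EqUpToSign (f x) (f y)) : EqUpToSign x y := by
  have h0 : (0 : ℝ) ∈ ({‖x + y‖, ‖x - y‖} : Set ℝ) := by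
    rw [← hf x y]
    rcases h with h | h <;> simp [h]
  rcases h0 with h0 | h0
  · exact Or.inr (eq_neg_of_add_eq_zero_left (norm_eq_zero.1 h0.symm))
  · exact Or.inl (sub_eq_zero.1 (norm_eq_zero.1 (Eq.symm h0)))

variable {X Y : Type*} [NormedAddCommGroup X] [NormedSpace ℝ X]
  [NormedAddCommGroup Y] [NormedSpace ℝ Y] {f : X → Y}

theorem IsPhaseIsometry.norm_map (hf : IsPhaseIsometry f) (x : X) : ‖f x‖ = ‖x‖ := by
  have h := hf x x
  have h1 : ‖f x + f x‖ ∈ ({‖x + x‖, ‖x - x‖} : Set ℝ) := h ▸ Set.mem_insert _ _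
  have h2 : ‖x + x‖ ∈ ({‖f x + f x‖, ‖f x - f x‖} : Set ℝ) := h ▸ Set.mem_insert _ _
  simp only [Set.mem_insert_iff, Set.mem_singleton_iff, sub_self, norm_zero, ← two_smul ℝ,
    norm_smul, Real.norm_ofNat] at h1 h2
  rcases h1 with h1 | h1
  · linarith
  · rcases h2 with h2 | h2 <;> linarith

theorem IsPhaseIsometry.linearIndependent_map (hf : IsPhaseIsometry f)
    (ha : ∀ (x : X) (t : ℝ), EqUpToSign (f (t • x)) (t • f x)) {x y : X}
    (hxy : LinearIndependent ℝ ![x, y]) : LinearIndependent ℝ ![f x, f y] := by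
  rw [LinearIndependent.pair_iff] at hxy ⊢
  intro s t hst
  have h : EqUpToSign (s • x) (t • y) := hf.eqUpToSign_of_map <|
    (ha x s).trans <| EqUpToSign.trans (Or.inr (eq_neg_of_add_eq_zero_left hst)) (ha y t).symm
  rcases h with h | h
  · have := hxy s (-t) (by rw [h]; module)
    exact ⟨this.1, neg_eq_zero.1 this.2⟩
  · exact hxy s t (by rw [h]; module)

/-! ### Sign-normalized lifts along `e` -/

/-- `v` is the value at `x` of a linear map agreeing with `f` up to sign on the span of
`e` and `x`, normalized to take the value `f e` at `e`. -/
def IsPhaseLift (f : X → Y) (e x : X) (v : Y) : Prop :=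
  ∀ a b : ℝ, EqUpToSign (f (a • e + b • x)) (a • f e + b • v)

namespace IsPhaseLift

variable {e x y : X} {v w : Y}

theorem map_eq (h : IsPhaseLift f e x v) : EqUpToSign (f x) v := by
  simpa using h 0 1

theorem map_add (h : IsPhaseLift f e x v) : EqUpToSign (f (e + x)) (f e + v) := by
  simpa using h 1 1

theorem combination (h : IsPhaseLift f e x v) (c d : ℝ) :
    IsPhaseLift f e (c • e + d • x) (c • f e + d • v) := by
  intro a b
  have h' := h (a + b * c) (b * d)
  rwa [show (a + b * c) • e + (b * d) • x = a • e + b • (c • e + d • x) by module,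
    show (a + b * c) • f e + (b * d) • v = a • f e + b • (c • f e + d • v) by module] at h'

theorem unique (he : f e ≠ 0) (hv : IsPhaseLift f e x v) (hw : IsPhaseLift f e x w) :
    v = w := by
  rcases hv.map_eq.symm.trans hw.map_eq with h | h
  · exact h
  · rcases hv.map_add.symm.trans hw.map_add with h' | h'
    · exact add_left_cancel h'
    · refine absurd ?_ he
      linear_combination (norm := module) (1 / 2 : ℝ) • h' - (1 / 2 : ℝ) • h

end IsPhaseLift

theorem exists_isPhaseLift (hf : IsPhaseIsometry f)
    (ha : ∀ (x : X) (t : ℝ), EqUpToSign (f (t • x)) (t • f x))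
    (hb : ∀ x y : X, LinearIndependent ℝ ![x, y] →
      EqUpToSign (f (x + y)) (f x + f y) ∨ EqUpToSign (f (x + y)) (f x - f y))
    {e : X} (he : e ≠ 0) (x : X) : ∃ v, IsPhaseLift f e x v := by
  by_cases hx : LinearIndependent ℝ ![e, x]
  swap
  · rw [LinearIndependent.pair_iff' he] at hx
    push Not at hx
    obtain ⟨t, rfl⟩ := hx
    refine ⟨t • f e, fun a b => ?_⟩
    have h := ha e (a + b * t)
    rwa [show (a + b * t) • e = a • e + b • t • e by module,
      show (a + b * t) • f e = a • f e + b • t • f e by module] at h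
  have hfe := LinearIndependent.pair_iff.1 (hf.linearIndependent_map ha hx)
  -- The value at `e + x` selects the sign of `v`; the rest shows that this choice serves every `e +
  -- t • x`.
  obtain ⟨v, hv, hev⟩ : ∃ v, EqUpToSign v (f x) ∧ EqUpToSign (f (e + x)) (f e + v) := by
    rcases hb e x hx with h | h
    · exact ⟨f x, Or.inl rfl, h⟩
    · exact ⟨-f x, Or.inr rfl, by rwa [← sub_eq_add_neg]⟩
  have hind : ∀ s t : ℝ, s • f e + t • v = 0 → s = 0 ∧ t = 0 := by
    intro s t h
    rcases hv with rfl | rfl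
    · exact hfe s t h
    · have := hfe s (-t) (by rw [← h]; module)
      exact ⟨this.1, neg_eq_zero.1 this.2⟩
  have hx' := LinearIndependent.pair_iff.1 hx
  have key : ∀ t : ℝ, EqUpToSign (f (e + t • x)) (f e + t • v) := by
    intro t
    rcases eq_or_ne t 0 with rfl | ht0
    · exact Or.inl (by simp)
    rcases eq_or_ne t 1 with rfl | ht1
    · simpa using hev
    have h1 : EqUpToSign (f (e + t • x)) (f e + t • v) ∨
        EqUpToSign (f (e + t • x)) (f e - t • v) := by
      have hi : LinearIndependent ℝ ![e, t • x] := LinearIndependent.pair_iff.2 fun a b h => by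
        have := hx' a (b * t) (by rw [← h]; module)
        exact ⟨this.1, (mul_eq_zero.1 this.2).resolve_right ht0⟩
      have hvt := (ha x t).trans (hv.symm.smul t)
      rcases hvt with hvt | hvt <;> rcases hb _ _ hi with h | h <;> rw [hvt] at h
      · exact Or.inl h
      · exact Or.inr h
      · exact Or.inr (by rwa [← sub_eq_add_neg] at h)
      · exact Or.inl (by rwa [sub_neg_eq_add] at h)
    rcases h1 with h1 | h1
    · exact h1
    exfalso
    -- Since `e + t • x = t • (e + x) + (1 - t) • e`, condition (b) gives coefficients `(1, t)` or
    -- `(2 * t - 1, t)` on `f e` and `v`, up to sign. Neither is `±(1, -t)` when `t ≠ 0`.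
    have hi : LinearIndependent ℝ ![t • (e + x), (1 - t) • e] :=
      LinearIndependent.pair_iff.2 fun a b h => by
        have h2 := hx' (a * t + b * (1 - t)) (a * t) (by rw [← h]; module)
        have ha0 : a = 0 := (mul_eq_zero.1 h2.2).resolve_right ht0
        refine ⟨ha0, (mul_eq_zero.1 ?_).resolve_right (sub_ne_zero.2 ht1.symm)⟩
        simpa [ha0] using h2.1
    have h3 : EqUpToSign (f (t • (e + x))) (t • (f e + v)) := (ha _ t).trans (hev.smul t)
    have h4 := ha e (1 - t)
    have h5 := hb _ _ hi
    rw [show t • (e + x) + (1 - t) • e = e + t • x by module] at h5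
    have h6 : EqUpToSign (f e - t • v) (t • (f e + v) + (1 - t) • f e) ∨
        EqUpToSign (f e - t • v) (t • (f e + v) - (1 - t) • f e) := by
      refine Or.imp h1.symm.trans h1.symm.trans ?_
      generalize f (e + t • x) = p at h5
      rcases h3 with h3 | h3 <;> rcases h4 with h4 | h4 <;> rw [h3, h4] at h5
      · exact h5
      · rw [sub_neg_eq_add, ← sub_eq_add_neg] at h5
        exact h5.symm
      · refine h5.symm.imp (fun h => h.trans (Or.inr ?_)) (fun h => h.trans (Or.inr ?_)) <;> module
      · refine h5.imp (fun h => h.trans (Or.inr ?_)) (fun h => h.trans (Or.inr ?_)) <;> module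
    rcases h6 with (h | h) | (h | h)
    · exact ht0 (by
        have := (hind 0 (2 * t) (by linear_combination (norm := module) -h)).2
        linarith)
    · have := (hind 2 0 (by linear_combination (norm := module) h)).1
      norm_num at this
    · exact ht0 (by
        have := (hind (2 - 2 * t) (-2 * t) (by linear_combination (norm := module) h)).2
        linarith)
    · exact ht0 (by
        have := (hind (2 * t) 0 (by linear_combination (norm := module) h)).1
        linarith)
  refine ⟨v, fun a b => ?_⟩
  rcases eq_or_ne a 0 with rfl | ha0
  · simpa using (ha x b).trans (hv.symm.smul b)
  · have h := (ha (e + (b / a) • x) a).trans ((key (b / a)).smul a)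
    simpa only [smul_add, smul_smul, mul_div_cancel₀ b ha0] using h

/-- The lift `u` of `x + y` is `±v ± w`. Splitting `e + x + y` as `y + (e + x)` and as `x + (e + y)`
rules out every choice but `v + w`. Only pairwise independence is needed, and parallel pairs reduce
to `combination`. -/
theorem IsPhaseLift.add (hf : IsPhaseIsometry f)
    (ha : ∀ (x : X) (t : ℝ), EqUpToSign (f (t • x)) (t • f x))
    (hb : ∀ x y : X, LinearIndependent ℝ ![x, y] →
      EqUpToSign (f (x + y)) (f x + f y) ∨ EqUpToSign (f (x + y)) (f x - f y))
    {e : X} (he : e ≠ 0) {x y : X} {v w : Y} (hv : IsPhaseLift f e x v)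
    (hw : IsPhaseLift f e y w) : IsPhaseLift f e (x + y) (v + w) := by
  have hfe : f e ≠ 0 := by rw [← norm_ne_zero_iff, hf.norm_map]; exact norm_ne_zero_iff.2 he
  -- the case where one of the vectors is an affine function of the other
  have aux : ∀ {x y : X} {v w : Y}, IsPhaseLift f e x v → IsPhaseLift f e y w →
      ∀ c d : ℝ, y = c • e + d • x → IsPhaseLift f e (x + y) (v + w) := by
    rintro x _ v w hv hw c d rfl
    rw [hw.unique hfe (hv.combination c d)]
    convert hv.combination c (d + 1) using 1 <;> module
  have aux' : ∀ c d : ℝ, x = c • e + d • y → IsPhaseLift f e (x + y) (v + w) := fun c d h => by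
    rw [add_comm x, add_comm v]
    exact aux hw hv c d h
  rcases eq_or_ne x 0 with hx0 | hx0
  · exact aux' 0 0 (by simp [hx0])
  rcases eq_or_ne y 0 with hy0 | hy0
  · exact aux hv hw 0 0 (by simp [hy0])
  by_cases hex : ∃ a : ℝ, a • e = x
  · obtain ⟨a, h⟩ := hex
    exact aux' a 0 (by rw [← h]; module)
  by_cases hey : ∃ a : ℝ, a • e = y
  · obtain ⟨a, h⟩ := hey
    exact aux hv hw a 0 (by rw [← h]; module)
  by_cases hxy : ∃ a : ℝ, a • x = y
  · obtain ⟨a, h⟩ := hxy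
    exact aux hv hw 0 a (by rw [← h]; module)
  -- Once these two cases are removed, (b) applies to `x, e + y` and to `y, e + x`.
  by_cases hexy : ∃ a : ℝ, a • x = e + y
  · obtain ⟨a, h⟩ := hexy
    exact aux hv hw (-1) a (by rw [h]; module)
  by_cases heyx : ∃ a : ℝ, a • y = e + x
  · obtain ⟨a, h⟩ := heyx
    exact aux' (-1) a (by rw [h]; module)
  push Not at hex hey hxy hexy heyx
  -- the images are pairwise distinct up to sign and nonzero
  have hne : ∀ {x y : X} {v w : Y}, EqUpToSign (f x) v → EqUpToSign (f y) w →
      (¬ ∃ a : ℝ, a • x = y) → ¬ EqUpToSign v w := by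
    intro x y v w hxv hyw hxy h
    rcases hf.eqUpToSign_of_map ((hxv.trans h).trans hyw.symm) with h | h
    · exact hxy ⟨1, by simp [h]⟩
    · exact hxy ⟨-1, by simp [h]⟩
  have hvw : ¬ EqUpToSign v w := hne hv.map_eq hw.map_eq (by simpa using hxy)
  have hev : ¬ EqUpToSign (f e) v := hne (Or.inl rfl) hv.map_eq (by simpa using hex)
  have hew : ¬ EqUpToSign (f e) w := hne (Or.inl rfl) hw.map_eq (by simpa using hey)
  have hnz : ∀ {x : X} {v : Y}, EqUpToSign (f x) v → x ≠ 0 → v ≠ 0 := by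
    rintro x v h hx rfl
    have : f x = 0 := by rcases h with h | h <;> simpa using h
    exact hx (norm_eq_zero.1 (by rw [← hf.norm_map, this, norm_zero]))
  have hv0 : v ≠ 0 := hnz hv.map_eq hx0
  have hw0 : w ≠ 0 := hnz hw.map_eq hy0
  have hsum : ∀ {x y : X} {v w : Y}, EqUpToSign (f x) v → EqUpToSign (f y) w → x ≠ 0 →
      (∀ a : ℝ, a • x ≠ y) →
      EqUpToSign (f (x + y)) (v + w) ∨ EqUpToSign (f (x + y)) (v - w) := by
    intro x y v w hxv hyw hx hxy
    have h5 := hb x y ((LinearIndependent.pair_iff' hx).2 hxy)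
    generalize f (x + y) = p at h5
    rcases hxv with h3 | h3 <;> rcases hyw with h4 | h4 <;> rw [h3, h4] at h5
    · exact h5
    · rw [sub_neg_eq_add, ← sub_eq_add_neg] at h5
      exact h5.symm
    · refine h5.symm.imp (fun h => h.trans (Or.inr ?_)) (fun h => h.trans (Or.inr ?_)) <;> module
    · refine h5.imp (fun h => h.trans (Or.inr ?_)) (fun h => h.trans (Or.inr ?_)) <;> module
  obtain ⟨u, hu⟩ := exists_isPhaseLift hf ha hb he (x + y)
  have hu1 := hu.map_eq.symm
  have hu2 := hu.map_add.symm
  have h1 : EqUpToSign u (v + w) ∨ EqUpToSign u (v - w) :=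
    (hsum hv.map_eq hw.map_eq hx0 hxy).imp hu1.trans hu1.trans
  have h2 : EqUpToSign (f e + u) (w + (f e + v)) ∨ EqUpToSign (f e + u) (w - (f e + v)) := by
    have := hsum hw.map_eq hv.map_add hy0 heyx
    rw [show y + (e + x) = e + (x + y) by abel] at this
    exact this.imp hu2.trans hu2.trans
  have h3 : EqUpToSign (f e + u) (v + (f e + w)) ∨ EqUpToSign (f e + u) (v - (f e + w)) := by
    have := hsum hv.map_eq hw.map_add hx0 hexy
    rw [show x + (e + y) = e + (x + y) by abel] at this
    exact this.imp hu2.trans hu2.trans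
  suffices u = v + w from this ▸ hu
  -- `h2` excludes `-(v + w)` and `w - v`; `h3` excludes `v - w`.
  rcases h1 with (rfl | rfl) | (rfl | rfl)
  · rfl
  · exfalso
    rcases h2 with (h | h) | (h | h)
    · exact hvw (Or.inr (by linear_combination (norm := module) (-1 / 2 : ℝ) • h))
    · exact hfe (by linear_combination (norm := module) (1 / 2 : ℝ) • h)
    · exact hew (Or.inl (by linear_combination (norm := module) (1 / 2 : ℝ) • h))
    · exact hv0 (by linear_combination (norm := module) (-1 / 2 : ℝ) • h)
  · exfalso
    rcases h3 with (h | h) | (h | h)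
    · exact hw0 (by linear_combination (norm := module) (-1 / 2 : ℝ) • h)
    · exact hev (Or.inr (by linear_combination (norm := module) (1 / 2 : ℝ) • h))
    · exact hfe (by linear_combination (norm := module) (1 / 2 : ℝ) • h)
    · exact hvw (Or.inl (by linear_combination (norm := module) (1 / 2 : ℝ) • h))
  · exfalso
    rcases h2 with (h | h) | (h | h)
    · exact hv0 (by linear_combination (norm := module) (-1 / 2 : ℝ) • h)
    · exact hew (Or.inr (by linear_combination (norm := module) (1 / 2 : ℝ) • h))
    · exact hfe (by linear_combination (norm := module) (1 / 2 : ℝ) • h)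
    · exact hvw (Or.inl (by linear_combination (norm := module) (-1 / 2 : ℝ) • h))

theorem isPhaseEquivLinearIsometry_of_linearMap (hf : IsPhaseIsometry f) (T : X →ₗ[ℝ] Y)
    (hT : ∀ x, EqUpToSign (f x) (T x)) : IsPhaseEquivLinearIsometry f := by
  have hε : ∀ x, ∃ ε : ℝ, (ε = -1 ∨ ε = 1) ∧ ε • f x = T x := fun x => by
    rcases hT x with h | h
    · exact ⟨1, Or.inr rfl, by rw [one_smul, h]⟩
    · exact ⟨-1, Or.inl rfl, by rw [h]; module⟩
  choose ε hε hεT using hε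
  refine ⟨ε, hε, ⟨T, fun x => ?_⟩, hεT⟩
  rw [← hf.norm_map x]
  rcases hT x with h | h <;> simp [h]

end PhaseIsometry

theorem proposition2p4 {X Y : Type*} [NormedAddCommGroup X] [NormedSpace ℝ X]
    [NormedAddCommGroup Y] [NormedSpace ℝ Y] (f : X → Y)
    (hsurj : Function.Surjective f) (hf : IsPhaseIsometry f)
    (ha : ∀ (x : X) (t : ℝ), f (t • x) = t • f x ∨ f (t • x) = -(t • f x))
    (hb : ∀ x y : X, LinearIndependent ℝ ![x, y] →
      ∃ α β : ℝ, |α| = 1 ∧ |β| = 1 ∧ f (x + y) = α • f x + β • f y) :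
    IsPhaseEquivLinearIsometry f := by
  have hb' : ∀ x y : X, LinearIndependent ℝ ![x, y] →
      EqUpToSign (f (x + y)) (f x + f y) ∨ EqUpToSign (f (x + y)) (f x - f y) := by
    intro x y hxy
    obtain ⟨α, β, hα, hβ, h⟩ := hb x y hxy
    rcases eq_or_eq_neg_of_abs_eq hα with rfl | rfl <;>
      rcases eq_or_eq_neg_of_abs_eq hβ with rfl | rfl
    · exact Or.inl (Or.inl (by rw [h]; module))
    · exact Or.inr (Or.inl (by rw [h]; module))
    · exact Or.inr (Or.inr (by rw [h]; module))
    · exact Or.inl (Or.inr (by rw [h]; module))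
  rcases subsingleton_or_nontrivial X with hX | hX
  · refine isPhaseEquivLinearIsometry_of_linearMap hf 0 fun x => Or.inl ?_
    rw [LinearMap.zero_apply, ← norm_eq_zero, hf.norm_map, Subsingleton.elim x 0, norm_zero]
  obtain ⟨e, he⟩ := exists_ne (0 : X)
  have hfe : f e ≠ 0 := by rw [← norm_ne_zero_iff, hf.norm_map]; exact norm_ne_zero_iff.2 he
  choose g hg using exists_isPhaseLift hf ha hb' he
  refine isPhaseEquivLinearIsometry_of_linearMap hf
    { toFun := g
      map_add' := fun x y =>
        (hg (x + y)).unique hfe (IsPhaseLift.add hf ha hb' he (hg x) (hg y))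
      map_smul' := fun c x => (hg (c • x)).unique hfe ?_ }
    fun x => (hg x).map_eq
  simpa using (hg x).combination 0 c
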